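/- All graphs are finite and simple. Let $\mathrm{tw}(G)$, $\omega(G)$ and $\alpha(G)$ denote the treewidth, the clique number and the independence number of a graph $G$. A function $f$ from $\mathbb{N}$ to the real numbers is a \emph{$(\mathrm{tw},\omega)$-binding function} for a graph class $\mathcal{G}$ if $\mathrm{tw}(G')\le f(\omega(G'))$ for every $G\in\mathcal{G}$ and every induced subgraph $G'$ of $G$. A class is \emph{$(\mathrm{tw},\omega)$-bounded} if it has a $(\mathrm{tw},\omega)$-binding function $\mathbb{N}\to\mathbb{N}$, and \emph{polynomially $(\mathrm{tw},\omega)$-bounded} if it has such a function $\mathbb{N}\to\mathbb{N}$ that is given by a polynomial. \textbf{Theorem.} For every integer $q\ge 3$, let $\mathcal{G}_q$ denote the class of graphs $G$ with $\alpha(G)<q$. Then $\mathcal{G}_q$ is $(\mathrm{tw},\omega)$-bounded, and \begin{itemize} \item $\mathcal{G}_q$ has a $(\mathrm{tw},\omega)$-binding function $\mathbb{N}\to\mathbb{N}$ that is given by a polynomial of degree $q-1$; \item for every real $c>0$ and every real $\epsilon>0$, the function $f(k)=c\,k^{(q+1)/2-\epsilon}$ is not a $(\mathrm{tw},\omega)$-binding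 function for $\mathcal{G}_q$. \end{itemize} Consequently, there exists no polynomial that is a $(\mathrm{tw},\omega)$-binding function for all polynomially $(\mathrm{tw},\omega)$-bounded graph classes. -/

import Mathlib

open scoped Polynomial

/-- A tree decomposition of a graph `G`, with a tree on the (finite) node set `ι`. -/
structure TreeDecomposition {V : Type*} (G : SimpleGraph V) (ι : Type*) where
  /-- the underlying tree -/
  tree : SimpleGraph ι
  isTree : tree.IsTree
  /-- the vertex subset associated with each node -/
  bag : ι → Finset V
  /-- the bags cover the vertex set -/
  vertex_covered : ∀ v : V, ∃ t, v ∈ bag t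
  /-- every edge is contained in some bag -/
  edge_covered : ∀ u v : V, G.Adj u v → ∃ t, u ∈ bag t ∧ v ∈ bag t
  /-- the nodes whose bags contain a given vertex induce a connected subtree -/
  connected : ∀ v : V, (tree.induce {t | v ∈ bag t}).Connected

/-- The width of a tree decomposition: the maximum size of a bag, minus one. The truncated
subtraction matters only if all the bags are empty, that is, if the graph has no vertices. -/
def TreeDecomposition.width {V : Type*} {G : SimpleGraph V} {ι : Type*} [Fintype ι]
    (D : TreeDecomposition G ι) : ℕ :=
  (Finset.univ.sup fun t => (D.bag t).card) - 1

/-- The treewidth of a (finite) graph: the minimum width of a tree decomposition.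
Up to relabelling, the nodes of a finite tree are the elements of `Fin n`. -/
noncomputable def treewidth {V : Type*} (G : SimpleGraph V) : ℕ :=
  sInf {w | ∃ (n : ℕ) (D : TreeDecomposition G (Fin n)), D.width = w}

/-- A class of finite simple graphs, closed under isomorphism. -/
structure GraphClass where
  Mem : ∀ {V : Type} [Finite V], SimpleGraph V → Prop
  mem_of_iso : ∀ {V W : Type} [Finite V] [Finite W] {G : SimpleGraph V} {H : SimpleGraph W},
    Nonempty (G ≃g H) → Mem G → Mem H

/-- `f` is a (tw, ω)-binding function for `𝒢`: every induced subgraph `G'` of every graph in `𝒢`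
satisfies `tw(G') ≤ f(ω(G'))`. The values of `f` may be real, so that the notion also applies to
functions such as `k ↦ c k ^ s` with real `c` and `s`. -/
def GraphClass.IsTwOmegaBinding (𝒢 : GraphClass) (f : ℕ → ℝ) : Prop :=
  ∀ (V : Type) [Finite V] (G : SimpleGraph V), 𝒢.Mem G →
    ∀ s : Set V, (treewidth (G.induce s) : ℝ) ≤ f (G.induce s).cliqueNum

/-- `𝒢` is (tw, ω)-bounded: it has a (tw, ω)-binding function `ℕ → ℕ`. -/
def GraphClass.IsTwOmegaBounded (𝒢 : GraphClass) : Prop :=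
  ∃ f : ℕ → ℕ, 𝒢.IsTwOmegaBinding fun k => (f k : ℝ)

/-- `𝒢` is polynomially (tw, ω)-bounded: it has a (tw, ω)-binding function `ℕ → ℕ` that is given
by a polynomial. -/
def GraphClass.IsPolynomiallyTwOmegaBounded (𝒢 : GraphClass) : Prop :=
  ∃ (f : ℕ → ℕ) (p : ℝ[X]), (∀ k : ℕ, (f k : ℝ) = p.eval (k : ℝ)) ∧
    𝒢.IsTwOmegaBinding fun k => (f k : ℝ)

/-- An isomorphism does not decrease the independence number. -/
theorem indepNum_le_of_iso {V W : Type} [Finite V] [Finite W] {G : SimpleGraph V}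
    {H : SimpleGraph W} (e : G ≃g H) : H.indepNum ≤ G.indepNum := by
  obtain ⟨s, hs⟩ := H.exists_isNIndepSet_indepNum
  have h : G.IsIndepSet (s.map e.symm.toEquiv.toEmbedding : Finset V) := by
    intro a ha b hb hab hadj
    simp only [Finset.coe_map, Set.mem_image] at ha hb
    obtain ⟨x, hx, rfl⟩ := ha
    obtain ⟨y, hy, rfl⟩ := hb
    refine hs.isIndepSet hx hy (fun hxy => hab (by rw [hxy])) ?_
    exact e.symm.map_adj_iff.1 hadj
  have h' := h.card_le_indepNum
  rwa [Finset.card_map, hs.card_eq] at h'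

/-- The class of graphs with independence number less than `q`. -/
def boundedIndepClass (q : ℕ) : GraphClass where
  Mem G := G.indepNum < q
  mem_of_iso := fun ⟨e⟩ h => (indepNum_le_of_iso e).trans_lt h

/-! A nonempty graph with independence number less than `q` and clique number `k` has fewer than
`(k + q - 1).choose k` vertices by the Erdős–Szekeres bound, and its treewidth is less than its
number of vertices.

Conversely, in a rooted tree decomposition a vertex whose subtree starts farthest from the root has
all its neighbours in a single bag. Picking such vertices greedily shows that a graph `G` with `n`
vertices satisfies `n ≤ α(G) * (tw(G) + 1)`, so it is enough to find graphs without `q`-cliques and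
without independent `k`-sets on about `k ^ ((q + 1) / 2)` vertices: their complements have large
treewidth.

These come from a random graph with edge probability `p = k ^ (-σ)`, where `σ < 1`, by deleting
the edges of a maximal family of edge-disjoint `q`-cliques. If a `k`-set becomes independent, then
all its random edges lie in those members of the family that share an edge with it. Summing over
the possible families bounds the probability of this event by `(1 + x) ^ N * (1 - p) ^ M`, where
`x = (p / (1 - p)) ^ q.choose 2`, `M = k.choose 2`, and `N` is the number of potential `q`-cliques
that share an edge with the `k`-set. A union bound over all `k`-sets concludes.
-/

section Tree

variable {ι : Type*} {T : SimpleGraph ι} {S S' : Set ι} {r t t' x : ι}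

theorem exists_isPath_support_subset_of_preconnected_induce (hS : (T.induce S).Preconnected)
    (ht : t ∈ S) (hx : x ∈ S) : ∃ b : T.Walk t x, b.IsPath ∧ ∀ y ∈ b.support, y ∈ S := by
  obtain ⟨b, hb⟩ := (hS ⟨t, ht⟩ ⟨x, hx⟩).exists_isPath
  let φ : T.induce S ↪g T := SimpleGraph.Embedding.induce S
  refine ⟨b.map φ.toHom, hb.map φ.injective, fun y hy => ?_⟩
  obtain ⟨z, -, rfl⟩ := List.mem_map.1 ((b.support_map φ.toHom) ▸ hy)
  exact z.2

theorem isPath_append_of_forall_dist_le {a : T.Walk r t} {b : T.Walk t x}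
    (ha : a.length = T.dist r t) (hb : b.IsPath)
    (hmin : ∀ y ∈ b.support, T.dist r t ≤ T.dist r y) : (a.append b).IsPath := by
  classical
  have hb_nodup := hb.support_nodup
  rw [← SimpleGraph.Walk.cons_tail_support, List.nodup_cons] at hb_nodup
  rw [SimpleGraph.Walk.isPath_def, SimpleGraph.Walk.support_append, List.nodup_append]
  refine ⟨(a.isPath_of_length_eq_dist ha).support_nodup, hb_nodup.2, ?_⟩
  rintro y hya _ hyb rfl
  have hsplit := congrArg SimpleGraph.Walk.length (a.take_spec hya)
  rw [SimpleGraph.Walk.length_append] at hsplit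
  have hdrop : (a.dropUntil y hya).length = 0 := by
    have := hmin y (List.mem_of_mem_tail hyb)
    have := SimpleGraph.dist_le (a.takeUntil y hya)
    lia
  obtain rfl := SimpleGraph.Walk.eq_of_length_eq_zero hdrop
  exact hb_nodup.1 hyb

theorem exists_isPath_append_of_forall_dist_le (hT : T.Connected)
    (hS : (T.induce S).Preconnected) (ht : t ∈ S) (hmin : ∀ y ∈ S, T.dist r t ≤ T.dist r y)
    (hx : x ∈ S) :
    ∃ (a : T.Walk r t) (b : T.Walk t x), (a.append b).IsPath ∧ a.length = T.dist r t ∧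
      ∀ y ∈ b.support, y ∈ S := by
  obtain ⟨a, ha⟩ := hT.exists_walk_length_eq_dist r t
  obtain ⟨b, hb, hbS⟩ := exists_isPath_support_subset_of_preconnected_induce hS ht hx
  exact ⟨a, b, isPath_append_of_forall_dist_le ha hb fun y hy => hmin y (hbS y hy), ha, hbS⟩

theorem mem_of_inter_nonempty_of_dist_le (hT : T.IsTree) (hS : (T.induce S).Preconnected)
    (hS' : (T.induce S').Preconnected) (hSS' : (S ∩ S').Nonempty)
    (ht : t ∈ S) (hmin : ∀ y ∈ S, T.dist r t ≤ T.dist r y)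
    (ht' : t' ∈ S') (hmin' : ∀ y ∈ S', T.dist r t' ≤ T.dist r y)
    (hle : T.dist r t' ≤ T.dist r t) : t ∈ S' := by
  classical
  obtain ⟨x, hx, hx'⟩ := hSS'
  obtain ⟨a, b, hab, -, -⟩ := exists_isPath_append_of_forall_dist_le hT.connected hS ht hmin hx
  obtain ⟨a', b', hab', ha', hb'⟩ :=
    exists_isPath_append_of_forall_dist_le hT.connected hS' ht' hmin' hx'
  have hmem : t ∈ (a'.append b').support := by
    rw [← (hT.existsUnique_path r x).unique hab hab', SimpleGraph.Walk.mem_support_append_iff]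
    exact Or.inl a.end_mem_support
  rcases (SimpleGraph.Walk.mem_support_append_iff _ _).1 hmem with hta' | htb'
  · obtain rfl : t = t' := by
      by_contra hne
      have := a'.length_takeUntil_lt_length hta' hne
      have := SimpleGraph.dist_le (a'.takeUntil t hta')
      lia
    exact ht'
  · exact hb' t htb'

end Tree

namespace TreeDecomposition

variable {V ι : Type*} {G : SimpleGraph V}

theorem exists_mem_bag_forall_dist_le (D : TreeDecomposition G ι) (r : ι) (v : V) :
    ∃ t, v ∈ D.bag t ∧ ∀ y, v ∈ D.bag y → D.tree.dist r t ≤ D.tree.dist r y := by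
  obtain ⟨t, ht, hmin⟩ := exists_minimalFor_of_wellFoundedLT (fun t => v ∈ D.bag t)
    (D.tree.dist r) (D.vertex_covered v)
  exact ⟨t, ht, fun y hy => (le_total _ _).elim id (hmin hy)⟩

theorem exists_forall_adj_mem_bag (D : TreeDecomposition G ι) {W : Finset V} (hW : W.Nonempty) :
    ∃ v ∈ W, ∃ t, v ∈ D.bag t ∧ ∀ u ∈ W, G.Adj v u → u ∈ D.bag t := by
  -- Root the tree at `r` and take a vertex whose subtree starts farthest from the root.
  obtain ⟨r⟩ := D.isTree.connected.nonempty
  choose top htop hmin using D.exists_mem_bag_forall_dist_le r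
  obtain ⟨v, hv, hmax⟩ := W.exists_max_image (fun v => D.tree.dist r (top v)) hW
  refine ⟨v, hv, top v, htop v, fun u hu huv => ?_⟩
  have hu_top : top v ∈ {t | u ∈ D.bag t} :=
    mem_of_inter_nonempty_of_dist_le D.isTree (D.connected v).preconnected
      (D.connected u).preconnected (D.edge_covered v u huv) (htop v) (hmin v) (htop u) (hmin u)
      (hmax u hu)
  exact hu_top

theorem exists_isIndepSet_card_le (D : TreeDecomposition G ι) {b : ℕ}
    (hb : ∀ t, (D.bag t).card ≤ b) (W : Finset V) :
    ∃ I ⊆ W, G.IsIndepSet (I : Set V) ∧ W.card ≤ I.card * b := by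
  classical
  induction W using Finset.strongInduction with
  | H W ih =>
    rcases W.eq_empty_or_nonempty with rfl | hW
    · exact ⟨∅, by simp⟩
    obtain ⟨v, hv, t, hvt, ht⟩ := D.exists_forall_adj_mem_bag hW
    have hv_notMem : v ∉ W \ D.bag t := fun h => (Finset.mem_sdiff.1 h).2 hvt
    obtain ⟨I, hIW, hI, hcard⟩ := ih (W \ D.bag t)
      (Finset.sdiff_subset.ssubset_of_mem_notMem hv hv_notMem)
    have hadj : ∀ u ∈ I, ¬ G.Adj v u := fun u hu huv =>
      (Finset.mem_sdiff.1 (hIW hu)).2 (ht u (Finset.mem_sdiff.1 (hIW hu)).1 huv)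
    refine ⟨insert v I, Finset.insert_subset hv (hIW.trans Finset.sdiff_subset), ?_, ?_⟩
    · rw [Finset.coe_insert]
      exact hI.insert fun u hu _ => ⟨hadj u hu, fun h => hadj u hu h.symm⟩
    · rw [Finset.card_insert_of_notMem fun h => hv_notMem (hIW h), add_mul, one_mul]
      have := Finset.le_card_sdiff (D.bag t) W
      have := hb t
      lia

theorem card_bag_le_width_add_one [Fintype ι] (D : TreeDecomposition G ι) (t : ι) :
    (D.bag t).card ≤ D.width + 1 := by
  have : (D.bag t).card ≤ Finset.univ.sup fun t => (D.bag t).card :=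
    Finset.le_sup (f := fun t => (D.bag t).card) (Finset.mem_univ t)
  rw [width]
  lia

/-- The tree decomposition with a single bag, which contains all the vertices. -/
def single [Fintype V] (G : SimpleGraph V) : TreeDecomposition G (Fin 1) where
  tree := ⊥
  isTree := .of_subsingleton
  bag _ := Finset.univ
  vertex_covered v := ⟨0, Finset.mem_univ v⟩
  edge_covered u v _ := ⟨0, Finset.mem_univ u, Finset.mem_univ v⟩
  connected v :=
    have : Nonempty {_t : Fin 1 | v ∈ Finset.univ} := ⟨⟨0, Finset.mem_univ v⟩⟩
    SimpleGraph.IsTree.of_subsingleton.connected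

end TreeDecomposition

section Treewidth

theorem exists_treeDecomposition_width_eq_treewidth {V : Type*} [Finite V] (G : SimpleGraph V) :
    ∃ (n : ℕ) (D : TreeDecomposition G (Fin n)), D.width = treewidth G :=
  have := Fintype.ofFinite V
  Nat.sInf_mem (s := {w | ∃ (n : ℕ) (D : TreeDecomposition G (Fin n)), D.width = w})
    ⟨_, 1, .single G, rfl⟩

variable {V : Type*} [Fintype V] (G : SimpleGraph V)

theorem treewidth_le_card_sub_one : treewidth G ≤ Fintype.card V - 1 :=
  Nat.sInf_le ⟨1, .single G, by simp [TreeDecomposition.width, TreeDecomposition.single]⟩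

theorem card_le_indepNum_mul_treewidth_add_one :
    Fintype.card V ≤ G.indepNum * (treewidth G + 1) := by
  obtain ⟨n, D, hD⟩ := exists_treeDecomposition_width_eq_treewidth G
  obtain ⟨I, -, hI, hcard⟩ :=
    D.exists_isIndepSet_card_le (fun t => hD ▸ D.card_bag_le_width_add_one t) Finset.univ
  exact hcard.trans (Nat.mul_le_mul_right _ hI.card_le_indepNum)

end Treewidth

section ErdosSzekeres

variable {V : Type*} {G : SimpleGraph V}

theorem card_filter_adj_add_card_filter_compl_adj [DecidableEq V] [DecidableRel G.Adj]
    {W : Finset V} {v : V} (hv : v ∈ W) :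
    (W.filter (G.Adj v)).card + (W.filter (Gᶜ.Adj v)).card + 1 = W.card := by
  have hadj : W.filter (G.Adj v) = (W.erase v).filter (G.Adj v) := by
    ext u
    have : G.Adj v u → v ≠ u := SimpleGraph.Adj.ne
    grind
  have hcompl : W.filter (Gᶜ.Adj v) = (W.erase v).filter (¬ G.Adj v ·) := by
    ext u
    grind [SimpleGraph.compl_adj]
  rw [hadj, hcompl, Finset.card_filter_add_card_filter_not, Finset.card_erase_add_one hv]

theorem card_lt_choose_of_cliqueFreeOn {a b : ℕ} {W : Finset V}
    (hclique : G.CliqueFreeOn W (a + 1)) (hindep : Gᶜ.CliqueFreeOn W (b + 1)) :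
    W.card < (a + b).choose a := by
  classical
  rcases W.eq_empty_or_nonempty with rfl | ⟨v, hv⟩
  · exact Nat.choose_pos (Nat.le_add_right a b)
  have hA : G.CliqueFreeOn (W.filter (G.Adj v)) a :=
    (hclique.of_succ _ hv).subset _ fun u hu => Finset.mem_filter.1 hu
  have hB : Gᶜ.CliqueFreeOn (W.filter (Gᶜ.Adj v)) b :=
    (hindep.of_succ _ hv).subset _ fun u hu => Finset.mem_filter.1 hu
  match a, b with
  | 0, _ => exact absurd (SimpleGraph.isNClique_zero.2 rfl) (hA (t := ∅) (by simp))
  | _ + 1, 0 => exact absurd (SimpleGraph.isNClique_zero.2 rfl) (hB (t := ∅) (by simp))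
  | a + 1, b + 1 =>
    have hAcard := card_lt_choose_of_cliqueFreeOn hA
      (hindep.subset _ (Finset.coe_subset.2 (Finset.filter_subset _ _)))
    have hBcard := card_lt_choose_of_cliqueFreeOn
      (hclique.subset _ (Finset.coe_subset.2 (Finset.filter_subset _ _))) hB
    have hW := card_filter_adj_add_card_filter_compl_adj (G := G) hv
    have hpascal : (a + 1 + (b + 1)).choose (a + 1) =
        (a + (b + 1)).choose a + (a + 1 + b).choose (a + 1) := by
      rw [Nat.add_right_comm, Nat.choose_succ_succ, Nat.add_right_comm, Nat.add_assoc]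
    lia
termination_by a + b

theorem cliqueFree_iff_cliqueNum_lt [Finite V] {n : ℕ} : G.CliqueFree n ↔ G.cliqueNum < n := by
  refine ⟨fun h => ?_, fun h s hs => h.not_ge (hs.card_eq ▸ hs.isClique.card_le_cliqueNum)⟩
  by_contra! hle
  obtain ⟨s, hs⟩ := G.exists_isNClique_cliqueNum
  exact h.mono hle s hs

theorem card_lt_choose_cliqueNum [Fintype V] (G : SimpleGraph V) :
    Fintype.card V < (G.cliqueNum + G.indepNum).choose G.cliqueNum := by
  have hfree (H : SimpleGraph V) : H.CliqueFreeOn (Finset.univ : Finset V) (H.cliqueNum + 1) :=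
    (cliqueFree_iff_cliqueNum_lt.2 (Nat.lt_succ_self _)).cliqueFreeOn
  rw [← Finset.card_univ, ← SimpleGraph.cliqueNum_compl]
  exact card_lt_choose_of_cliqueFreeOn (hfree G) (hfree Gᶜ)

end ErdosSzekeres

theorem indepNum_induce_le {V : Type*} [Finite V] (G : SimpleGraph V) (s : Set V) :
    (G.induce s).indepNum ≤ G.indepNum := by
  have hcompl : (G.induce s)ᶜ = Gᶜ.induce s := by
    ext x y
    simp [Subtype.ext_iff]
  rw [← SimpleGraph.cliqueNum_compl, ← SimpleGraph.cliqueNum_compl, hcompl]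
  exact SimpleGraph.cliqueNum_induce_le s

theorem eval_preHilbertPoly_zero (d k : ℕ) :
    (Polynomial.preHilbertPoly ℝ d 0).eval (k : ℝ) = ((k + d).choose d : ℕ) := by
  simpa using Polynomial.preHilbertPoly_eq_choose_sub_add ℝ d k.zero_le

theorem isTwOmegaBinding_choose {q : ℕ} (hq : 1 ≤ q) :
    (boundedIndepClass q).IsTwOmegaBinding fun k => ((k + (q - 1)).choose (q - 1) : ℕ) := by
  intro V _ G hG s
  have := Fintype.ofFinite s
  have hindep : (G.induce s).indepNum < q := (indepNum_induce_le G s).trans_lt hG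
  generalize G.induce s = G' at *
  refine Nat.cast_le.2 ?_
  calc treewidth G' ≤ Fintype.card s - 1 := treewidth_le_card_sub_one G'
    _ ≤ Fintype.card s := Nat.sub_le _ _
    _ ≤ (G'.cliqueNum + G'.indepNum).choose G'.cliqueNum := (card_lt_choose_cliqueNum G').le
    _ ≤ (G'.cliqueNum + (q - 1)).choose G'.cliqueNum := Nat.choose_le_choose _ (by lia)
    _ = (G'.cliqueNum + (q - 1)).choose (q - 1) := Nat.choose_symm_add

theorem isPolynomiallyTwOmegaBounded_boundedIndepClass {q : ℕ} (hq : 1 ≤ q) :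
    (boundedIndepClass q).IsPolynomiallyTwOmegaBounded :=
  ⟨_, .preHilbertPoly ℝ (q - 1) 0, fun k => (eval_preHilbertPoly_zero (q - 1) k).symm,
    isTwOmegaBinding_choose hq⟩

section RandomSubset

open MeasureTheory ProbabilityTheory

variable {α : Type*} {p : unitInterval} {A B t : Finset α}
  {K F : Finset (Finset α)} {Q m : ℕ}

theorem setBernoulli_real_setOf_subset_and_disjoint (hAB : Disjoint A B) :
    setBer(Set.univ, p).real {E | (A : Set α) ⊆ E ∧ Disjoint (B : Set α) E} =
      p ^ A.card * (1 - p : ℝ) ^ B.card := by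
  classical
  have hpi : (fun P : α → Prop => {i | P i}) ⁻¹' {E | (A : Set α) ⊆ E ∧ Disjoint (B : Set α) E} =
      Set.pi (A ∪ B : Finset α) fun i => {i ∈ A} := by
    ext P
    have := Finset.disjoint_left.1 hAB
    simp only [Set.mem_preimage, Set.mem_ofPred_eq, Set.subset_def, Set.disjoint_left, Set.mem_pi,
      Finset.coe_union, Set.mem_union, Finset.mem_coe, Set.mem_singleton_iff, eq_iff_iff]
    grind
  rw [measureReal_def, setBernoulli_apply', hpi, Measure.infinitePi_pi _ (by simp),
    Finset.prod_union hAB,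
    Finset.prod_congr (s₁ := A) rfl (g := fun _ => (unitInterval.toNNReal p : ENNReal)),
    Finset.prod_congr (s₁ := B) rfl
      (g := fun _ => (unitInterval.toNNReal (unitInterval.symm p) : ENNReal))]
  · simp
  · intro i hi
    simp [Finset.disjoint_right.1 hAB hi]
  · intro i hi
    simp [hi]

open Classical in
/-- The subfamilies of the finite set family `K` whose members are pairwise disjoint. Deleting the
union of a maximal packing by members contained in `E` leaves a set that contains no member of
`K`. -/
noncomputable def packings (K : Finset (Finset α)) : Finset (Finset (Finset α)) :=
  K.powerset.filter fun F => (F : Set (Finset α)).PairwiseDisjoint id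

theorem mem_packings :
    F ∈ packings K ↔ F ⊆ K ∧ (F : Set (Finset α)).PairwiseDisjoint id := by
  simp only [packings, Finset.mem_filter, Finset.mem_powerset]

theorem filter_mem_packings_filter (P : Finset α → Prop) [DecidablePred P] (hF : F ∈ packings K) :
    F.filter P ∈ packings (K.filter P) := by
  rw [mem_packings] at hF ⊢
  exact ⟨Finset.filter_subset_filter P hF.1,
    hF.2.subset (Finset.coe_subset.2 (Finset.filter_subset P F))⟩

theorem sum_packings_pow_card_le (K : Finset (Finset α)) {x : ℝ} (hx : 0 ≤ x) :
    ∑ F ∈ packings K, x ^ F.card ≤ (1 + x) ^ K.card := by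
  calc ∑ F ∈ packings K, x ^ F.card ≤ ∑ F ∈ K.powerset, x ^ F.card :=
        Finset.sum_le_sum_of_subset_of_nonneg
          (fun F hF => Finset.mem_powerset.2 (mem_packings.1 hF).1) fun _ _ _ => by positivity
    _ = (1 + x) ^ K.card := by
        simpa [add_comm] using Finset.sum_pow_mul_eq_add_pow x 1 K

variable [DecidableEq α]

theorem card_biUnion_of_mem_packings (hK : ∀ C ∈ K, C.card = Q) (hF : F ∈ packings K) :
    (F.biUnion id).card = F.card * Q := by
  obtain ⟨hFK, hdisj⟩ := mem_packings.1 hF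
  rw [Finset.card_biUnion hdisj]
  exact Finset.sum_const_nat fun C hC => hK C (hFK hC)

theorem exists_mem_packings_forall_not_subset_sdiff (hK : ∀ C ∈ K, C.Nonempty) (E : Set α) :
    ∃ F ∈ packings K, (F.biUnion id : Set α) ⊆ E ∧ ∀ C ∈ K, ¬ (C : Set α) ⊆ E \ F.biUnion id := by
  classical
  obtain ⟨F, hF, hmax⟩ := Finset.exists_max_image
    ((packings K).filter fun F => (F.biUnion id : Set α) ⊆ E) Finset.card
    ⟨∅, by simp [mem_packings]⟩
  obtain ⟨hFK, hFE⟩ := Finset.mem_filter.1 hF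
  refine ⟨F, hFK, hFE, fun C hC hCE => ?_⟩
  obtain ⟨hCE, hCF⟩ := Set.subset_sdiff.1 hCE
  have hdisj : ∀ D ∈ F, Disjoint C D := fun D hD =>
    (Finset.disjoint_coe.1 hCF).mono_right (Finset.subset_biUnion_of_mem id hD)
  have hC_notMem : C ∉ F := fun h => (hK C hC).ne_empty (disjoint_self.1 (hdisj C h))
  have hinsert : insert C F ∈ (packings K).filter fun F => (F.biUnion id : Set α) ⊆ E := by
    rw [mem_packings] at hFK
    rw [Finset.mem_filter, mem_packings, Finset.coe_insert, Finset.biUnion_insert,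
      Finset.coe_union]
    exact ⟨⟨Finset.insert_subset hC hFK.1, hFK.2.insert fun D hD _ => hdisj D hD⟩,
      Set.union_subset hCE hFE⟩
  have := hmax _ hinsert
  rw [Finset.card_insert_of_notMem hC_notMem] at this
  lia

theorem sdiff_biUnion_filter_not_disjoint (F : Finset (Finset α)) (t : Finset α) :
    t \ (F.filter fun C => ¬ Disjoint C t).biUnion id = t \ F.biUnion id := by
  ext e
  simp only [Finset.mem_sdiff, Finset.mem_biUnion, Finset.mem_filter, id_eq, Finset.disjoint_left]
  grind

theorem setBernoulli_real_setOf_biUnion_subset_le (hp : (p : ℝ) < 1)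
    (hK : ∀ C ∈ K, C.card = Q) (hF : F ∈ packings K) (ht : m ≤ t.card) :
    setBer(Set.univ, p).real
        {E | (F.biUnion id : Set α) ⊆ E ∧ Disjoint (t \ F.biUnion id : Set α) E} ≤
      ((p / (1 - p) : ℝ) ^ Q) ^ F.card * (1 - p) ^ m := by
  have hp0 : (0 : ℝ) ≤ p := p.2.1
  have hp' : (0 : ℝ) < 1 - p := sub_pos.2 hp
  have hm : m ≤ F.card * Q + (t \ F.biUnion id).card := by
    rw [← card_biUnion_of_mem_packings hK hF]
    have := Finset.le_card_sdiff (F.biUnion id) t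
    lia
  rw [← Finset.coe_sdiff, setBernoulli_real_setOf_subset_and_disjoint Finset.disjoint_sdiff,
    card_biUnion_of_mem_packings hK hF]
  calc (p : ℝ) ^ (F.card * Q) * (1 - p) ^ (t \ F.biUnion id).card
      = ((p / (1 - p) : ℝ) ^ Q) ^ F.card * (1 - p) ^ (F.card * Q + (t \ F.biUnion id).card) := by
        rw [← pow_mul, mul_comm Q, div_pow, pow_add, ← mul_assoc, div_mul_cancel₀]
        positivity
    _ ≤ ((p / (1 - p) : ℝ) ^ Q) ^ F.card * (1 - p) ^ m := by
        gcongr ?_ * ?_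
        exact pow_le_pow_of_le_one hp'.le (by linarith) hm

theorem setBernoulli_real_setOf_exists_packing_le (hp : (p : ℝ) < 1)
    (hK : ∀ C ∈ K, C.card = Q) (ht : m ≤ t.card) :
    setBer(Set.univ, p).real {E | ∃ F ∈ packings K, (F.biUnion id : Set α) ⊆ E ∧
        Disjoint (t \ F.biUnion id : Set α) E} ≤
      (1 + (p / (1 - p) : ℝ) ^ Q) ^ K.card * (1 - p) ^ m := by
  have hp0 : (0 : ℝ) ≤ p := p.2.1
  have : (0 : ℝ) < 1 - p := sub_pos.2 hp
  have hunion : {E : Set α | ∃ F ∈ packings K, (F.biUnion id : Set α) ⊆ E ∧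
      Disjoint (t \ F.biUnion id : Set α) E} = ⋃ F ∈ packings K,
        {E | (F.biUnion id : Set α) ⊆ E ∧ Disjoint (t \ F.biUnion id : Set α) E} := by
    ext E
    simp only [Set.mem_iUnion, Set.mem_ofPred_eq, exists_prop]
  rw [hunion]
  calc _ ≤ ∑ F ∈ packings K, setBer(Set.univ, p).real
        {E | (F.biUnion id : Set α) ⊆ E ∧ Disjoint (t \ F.biUnion id : Set α) E} :=
        measureReal_biUnion_finset_le _ _
    _ ≤ ∑ F ∈ packings K, ((p / (1 - p) : ℝ) ^ Q) ^ F.card * (1 - p) ^ m :=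
        Finset.sum_le_sum fun F hF => setBernoulli_real_setOf_biUnion_subset_le hp hK hF ht
    _ ≤ (1 + (p / (1 - p) : ℝ) ^ Q) ^ K.card * (1 - p) ^ m := by
        rw [← Finset.sum_mul]
        gcongr
        exact sum_packings_pow_card_le K (by positivity)

theorem exists_set_forall_not_subset_forall_not_disjoint {T : Finset (Finset α)} {N : ℕ}
    (hp : (p : ℝ) < 1) (hQ : 1 ≤ Q) (hK : ∀ C ∈ K, C.card = Q) (hT : ∀ t ∈ T, m ≤ t.card)
    (hN : ∀ t ∈ T, (K.filter fun C => ¬ Disjoint C t).card ≤ N)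
    (hlt : T.card * ((1 + (p / (1 - p) : ℝ) ^ Q) ^ N * (1 - p) ^ m) < 1) :
    ∃ E : Set α, (∀ C ∈ K, ¬ (C : Set α) ⊆ E) ∧ ∀ t ∈ T, ¬ Disjoint (t : Set α) E := by
  have hp0 : (0 : ℝ) ≤ p := p.2.1
  have : (0 : ℝ) < 1 - p := sub_pos.2 hp
  let bad (t : Finset α) : Set (Set α) :=
    {E | ∃ F ∈ packings (K.filter fun C => ¬ Disjoint C t), (F.biUnion id : Set α) ⊆ E ∧
      Disjoint (t \ F.biUnion id : Set α) E}
  have hbad : ∀ t ∈ T, setBer(Set.univ, p).real (bad t) ≤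
      (1 + (p / (1 - p) : ℝ) ^ Q) ^ N * (1 - p) ^ m := fun t ht => by
    refine (setBernoulli_real_setOf_exists_packing_le hp
      (fun C hC => hK C (Finset.mem_filter.1 hC).1) (hT t ht)).trans ?_
    gcongr
    · exact le_add_of_nonneg_right (by positivity)
    · exact hN t ht
  have hbad_union : setBer(Set.univ, p).real (⋃ t ∈ T, bad t) < 1 :=
    calc _ ≤ ∑ t ∈ T, setBer(Set.univ, p).real (bad t) := measureReal_biUnion_finset_le _ _
      _ ≤ T.card • ((1 + (p / (1 - p) : ℝ) ^ Q) ^ N * (1 - p) ^ m) :=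
        Finset.sum_le_card_nsmul _ _ _ hbad
      _ < 1 := by rwa [nsmul_eq_mul]
  obtain ⟨E, hE⟩ : ∃ E, E ∉ ⋃ t ∈ T, bad t := by
    by_contra! h
    rw [Set.eq_univ_of_forall h, probReal_univ] at hbad_union
    exact hbad_union.false
  obtain ⟨F, hF, hFE, hfree⟩ := exists_mem_packings_forall_not_subset_sdiff
    (fun C hC => Finset.card_pos.1 (by rw [hK C hC]; exact hQ)) E
  refine ⟨E \ F.biUnion id, hfree, fun t ht hdisj => hE ?_⟩
  refine Set.mem_biUnion ht ⟨F.filter fun C => ¬ Disjoint C t,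
    filter_mem_packings_filter _ hF, ?_, ?_⟩
  · exact (Finset.coe_subset.2 (Finset.biUnion_subset_biUnion_of_subset_left _
      (Finset.filter_subset _ _))).trans hFE
  · rw [← Finset.coe_sdiff, sdiff_biUnion_filter_not_disjoint, Finset.coe_sdiff]
    rw [Set.disjoint_left] at hdisj ⊢
    exact fun e he heE => hdisj he.1 ⟨heE, he.2⟩

end RandomSubset

section GraphOfPairs

variable {V : Type*} [DecidableEq V]

theorem not_disjoint_powersetCard {S T : Finset V} {r : ℕ} :
    ¬ Disjoint (S.powersetCard r) (T.powersetCard r) ↔ r ≤ (S ∩ T).card := by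
  rw [Finset.not_disjoint_iff]
  constructor
  · rintro ⟨R, hS, hT⟩
    rw [Finset.mem_powersetCard] at hS hT
    exact hS.2 ▸ Finset.card_le_card (Finset.subset_inter hS.1 hT.1)
  · intro h
    obtain ⟨R, hR, hcard⟩ := Finset.exists_subset_card_eq h
    rw [Finset.subset_inter_iff] at hR
    exact ⟨R, Finset.mem_powersetCard.2 ⟨hR.1, hcard⟩, Finset.mem_powersetCard.2 ⟨hR.2, hcard⟩⟩

theorem card_filter_le_card_inter_le [Fintype V] (T : Finset V) (q r : ℕ) :
    ((Finset.univ.powersetCard q).filter fun S : Finset V => r ≤ (S ∩ T).card).card ≤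
      T.card.choose r * (Fintype.card V).choose (q - r) := by
  have hsubset : ((Finset.univ.powersetCard q).filter fun S : Finset V => r ≤ (S ∩ T).card) ⊆
      (T.powersetCard r ×ˢ Finset.univ.powersetCard (q - r)).image fun R => R.1 ∪ R.2 := by
    intro S hS
    obtain ⟨hS, hr⟩ := Finset.mem_filter.1 hS
    obtain ⟨R, hR, hcard⟩ := Finset.exists_subset_card_eq hr
    rw [Finset.subset_inter_iff] at hR
    have hSR : (S \ R).card = q - r := by
      rw [Finset.card_sdiff_of_subset hR.1, (Finset.mem_powersetCard.1 hS).2, hcard]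
    exact Finset.mem_image.2 ⟨(R, S \ R), Finset.mem_product.2
      ⟨Finset.mem_powersetCard.2 ⟨hR.2, hcard⟩,
        Finset.mem_powersetCard.2 ⟨Finset.subset_univ _, hSR⟩⟩,
      Finset.union_sdiff_of_subset hR.1⟩
  calc _ ≤ _ := Finset.card_le_card hsubset
    _ ≤ _ := Finset.card_image_le
    _ = _ := by
      rw [Finset.card_product, Finset.card_powersetCard, Finset.card_powersetCard,
        Finset.card_univ]

/-- The graph in which two distinct vertices are adjacent when the pair that they form belongs to
`E`. Edges are sets of two vertices here, so that the edges of the complete graph on a vertex set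
`S` are the members of `S.powersetCard 2`. -/
def graphOfPairs (E : Set (Finset V)) : SimpleGraph V :=
  SimpleGraph.fromEdgeSet {e | e.toFinset ∈ E}

variable {E : Set (Finset V)}

theorem graphOfPairs_adj {u v : V} : (graphOfPairs E).Adj u v ↔ {u, v} ∈ E ∧ u ≠ v := by
  rw [graphOfPairs, SimpleGraph.fromEdgeSet_adj, Set.mem_ofPred_eq, Sym2.toFinset_mk_eq]

theorem isClique_graphOfPairs {S : Finset V} :
    (graphOfPairs E).IsClique (S : Set V) ↔ (S.powersetCard 2 : Set (Finset V)) ⊆ E := by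
  refine ⟨fun h e he => ?_, fun h u hu v hv huv => graphOfPairs_adj.2 ⟨h ?_, huv⟩⟩
  · obtain ⟨heS, hcard⟩ := Finset.mem_powersetCard.1 he
    obtain ⟨u, v, huv, rfl⟩ := Finset.card_eq_two.1 hcard
    rw [Finset.insert_subset_iff, Finset.singleton_subset_iff] at heS
    exact (graphOfPairs_adj.1 (h heS.1 heS.2 huv)).1
  · exact Finset.mem_powersetCard.2 ⟨Finset.insert_subset hu (Finset.singleton_subset_iff.2 hv),
      Finset.card_pair huv⟩

theorem isIndepSet_graphOfPairs {S : Finset V} :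
    (graphOfPairs E).IsIndepSet (S : Set V) ↔ Disjoint (S.powersetCard 2 : Set (Finset V)) E := by
  rw [Set.disjoint_left]
  refine ⟨fun h e he heE => ?_, fun h u hu v hv huv huv_adj => h ?_ (graphOfPairs_adj.1 huv_adj).1⟩
  · obtain ⟨heS, hcard⟩ := Finset.mem_powersetCard.1 he
    obtain ⟨u, v, huv, rfl⟩ := Finset.card_eq_two.1 hcard
    rw [Finset.insert_subset_iff, Finset.singleton_subset_iff] at heS
    exact h heS.1 heS.2 huv (graphOfPairs_adj.2 ⟨heE, huv⟩)
  · exact Finset.mem_powersetCard.2 ⟨Finset.insert_subset hu (Finset.singleton_subset_iff.2 hv),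
      Finset.card_pair huv⟩

end GraphOfPairs

section Ramsey

variable (V : Type*) [Fintype V] {q k : ℕ}

theorem exists_cliqueFree_indepSetFree {p : unitInterval}
    (hp : (p : ℝ) < 1) (hq : 2 ≤ q)
    (hlt : (Fintype.card V : ℝ) ^ k * ((1 + (p / (1 - p) : ℝ) ^ q.choose 2) ^
      (k.choose 2 * Fintype.card V ^ (q - 2)) * (1 - p) ^ k.choose 2) < 1) :
    ∃ H : SimpleGraph V, H.CliqueFree q ∧ H.IndepSetFree k := by
  classical
  have : (0 : ℝ) < 1 - p := sub_pos.2 hp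
  have hp0 : (0 : ℝ) ≤ p := p.2.1
  let completeGraphs (j : ℕ) : Finset (Finset (Finset V)) :=
    (Finset.univ.powersetCard j).image (Finset.powersetCard 2)
  have hmem {j : ℕ} {S : Finset V} (hS : S.card = j) : S.powersetCard 2 ∈ completeGraphs j :=
    Finset.mem_image_of_mem _ (Finset.mem_powersetCard.2 ⟨S.subset_univ, hS⟩)
  have hcard (j : ℕ) : ∀ C ∈ completeGraphs j, C.card = j.choose 2 := by
    simp only [completeGraphs, Finset.forall_mem_image, Finset.mem_powersetCard,
      Finset.card_powersetCard]
    rintro S ⟨-, rfl⟩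
    rfl
  have hmeet : ∀ t ∈ completeGraphs k, ((completeGraphs q).filter fun C => ¬ Disjoint C t).card ≤
      k.choose 2 * Fintype.card V ^ (q - 2) := by
    simp only [completeGraphs, Finset.forall_mem_image, Finset.mem_powersetCard,
      Finset.filter_image, not_disjoint_powersetCard]
    rintro T ⟨-, rfl⟩
    exact Finset.card_image_le.trans ((card_filter_le_card_inter_le T q 2).trans
      (Nat.mul_le_mul_left _ (Nat.choose_le_pow _ _)))
  have hcard_le : (completeGraphs k).card ≤ Fintype.card V ^ k := by
    refine Finset.card_image_le.trans ?_
    rw [Finset.card_powersetCard, Finset.card_univ]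
    exact Nat.choose_le_pow _ _
  obtain ⟨E, hclique, hindep⟩ := exists_set_forall_not_subset_forall_not_disjoint hp
    (Nat.choose_pos hq) (hcard q) (fun t ht => (hcard k t ht).ge) hmeet (lt_of_le_of_lt
      (mul_le_mul_of_nonneg_right (mod_cast hcard_le) (by positivity)) hlt)
  exact ⟨graphOfPairs E,
    fun S hS => hclique _ (hmem hS.card_eq) (isClique_graphOfPairs.1 hS.isClique),
    fun S hS => hindep _ (hmem hS.card_eq) (isIndepSet_graphOfPairs.1 hS.isIndepSet)⟩

theorem exists_cliqueFree_indepSetFree_of_log_lt {p : ℝ} (hp0 : 0 ≤ p) (hp : p ≤ 1 / 2)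
    (hq : 2 ≤ q) (hk : 1 ≤ k)
    (hlt : Real.log (Fintype.card V) <
      (k - 1) / 2 * (p - (Fintype.card V : ℝ) ^ (q - 2) * (2 * p) ^ q.choose 2)) :
    ∃ H : SimpleGraph V, H.CliqueFree q ∧ H.IndepSetFree k := by
  set n := Fintype.card V
  have hp' : 0 < 1 - p := by linarith
  have hk' : (0 : ℝ) < k := by exact_mod_cast hk
  have hpow : (n : ℝ) ^ k ≤ Real.exp (k * Real.log n) := by
    rw [Real.exp_nat_mul]
    exact pow_le_pow_left₀ n.cast_nonneg (Real.le_exp_log _) k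
  have hodds : p / (1 - p) ≤ 2 * p := by
    rw [div_le_iff₀ hp']
    nlinarith
  have hpacking : (1 + (p / (1 - p)) ^ q.choose 2) ^ (k.choose 2 * n ^ (q - 2)) ≤
      Real.exp ((k.choose 2 * n ^ (q - 2) : ℕ) * (2 * p) ^ q.choose 2) := by
    rw [Real.exp_nat_mul]
    gcongr
    grw [hodds, add_comm, Real.add_one_le_exp]
  have hindep : (1 - p) ^ k.choose 2 ≤ Real.exp (k.choose 2 * -p) := by
    rw [Real.exp_nat_mul]
    exact pow_le_pow_left₀ hp'.le (Real.one_sub_le_exp_neg p) _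
  refine exists_cliqueFree_indepSetFree V (p := ⟨p, hp0, by linarith⟩) (sub_pos.1 hp') hq ?_
  calc (n : ℝ) ^ k * ((1 + (p / (1 - p)) ^ q.choose 2) ^ (k.choose 2 * n ^ (q - 2)) *
        (1 - p) ^ k.choose 2)
      ≤ Real.exp (k * Real.log n) * (Real.exp ((k.choose 2 * n ^ (q - 2) : ℕ) *
        (2 * p) ^ q.choose 2) * Real.exp (k.choose 2 * -p)) := by gcongr
    _ = Real.exp (k * (Real.log n - (k - 1) / 2 * (p - n ^ (q - 2) * (2 * p) ^ q.choose 2))) := by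
        rw [← Real.exp_add, ← Real.exp_add]
        push_cast [Nat.cast_choose_two]
        ring_nf
    _ < 1 := Real.exp_lt_one_iff.2 (mul_neg_of_pos_of_neg hk' (sub_neg.2 hlt))

end Ramsey

section Asymptotics

open Asymptotics Filter

variable {t σ : ℝ} {q : ℕ}

theorem tendsto_natCast_rpow_atTop (ht : 0 < t) :
    Tendsto (fun k : ℕ => (k : ℝ) ^ t) atTop atTop :=
  (tendsto_rpow_atTop ht).comp tendsto_natCast_atTop_atTop

theorem isLittleO_natCast_rpow_rpow {a b : ℝ} (hab : a < b) :
    (fun k : ℕ => (k : ℝ) ^ a) =o[atTop] fun k => (k : ℝ) ^ b := by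
  have hone : (fun k : ℕ => (k : ℝ) ^ (-(b - a))) =o[atTop] fun _ => (1 : ℝ) :=
    (isLittleO_one_iff ℝ).2
      ((tendsto_rpow_neg_atTop (sub_pos.2 hab)).comp tendsto_natCast_atTop_atTop)
  refine ((isBigO_refl (fun k : ℕ => (k : ℝ) ^ b) atTop).mul_isLittleO hone).congr' ?_ ?_
  · filter_upwards [eventually_gt_atTop 0] with k hk
    rw [← Real.rpow_add (by positivity), neg_sub, add_sub_cancel]
  · exact .of_forall fun k => mul_one _

theorem isBigO_natCeil_rpow (ht : 0 < t) :
    (fun k : ℕ => (⌈(k : ℝ) ^ t⌉₊ : ℝ)) =O[atTop] fun k => (k : ℝ) ^ t :=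
  isEquivalent_nat_ceil.isBigO.comp_tendsto (tendsto_natCast_rpow_atTop ht)

theorem isLittleO_log_natCeil_rpow (ht : 0 < t) {s : ℝ} (hs : 0 < s) :
    (fun k : ℕ => Real.log ⌈(k : ℝ) ^ t⌉₊) =o[atTop] fun k => (k : ℝ) ^ s := by
  have hceil : Tendsto (fun k : ℕ => (⌈(k : ℝ) ^ t⌉₊ : ℝ)) atTop atTop :=
    tendsto_natCast_atTop_atTop.comp (tendsto_nat_ceil_atTop.comp (tendsto_natCast_rpow_atTop ht))
  have hlog : (fun k : ℕ => Real.log ⌈(k : ℝ) ^ t⌉₊) =o[atTop]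
      fun k => (⌈(k : ℝ) ^ t⌉₊ : ℝ) ^ (s / t) :=
    (isLittleO_log_rpow_atTop (div_pos hs ht)).comp_tendsto hceil
  have hpow : (fun k : ℕ => (⌈(k : ℝ) ^ t⌉₊ : ℝ) ^ (s / t)) =O[atTop]
      fun k => ((k : ℝ) ^ t) ^ (s / t) :=
    (isBigO_natCeil_rpow ht).rpow (by positivity) (.of_forall fun k => by positivity)
  refine (hlog.trans_isBigO hpow).congr_right fun k => ?_
  rw [← Real.rpow_mul k.cast_nonneg, mul_div_cancel₀ _ ht.ne']

theorem isLittleO_natCeil_pow_mul_pow_choose_two (hq : 3 ≤ q) (ht : 0 < t)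
    (hσ : t < σ * ((q + 1) / 2)) :
    (fun k : ℕ => (⌈(k : ℝ) ^ t⌉₊ : ℝ) ^ (q - 2) * (2 * (k : ℝ) ^ (-σ)) ^ q.choose 2) =o[atTop]
      fun k => (k : ℝ) ^ (-σ) := by
  have hq' : (3 : ℝ) ≤ q := by exact_mod_cast hq
  have hbigO : (fun k : ℕ => (⌈(k : ℝ) ^ t⌉₊ : ℝ) ^ (q - 2) *
      (2 * (k : ℝ) ^ (-σ)) ^ q.choose 2) =O[atTop]
      fun k => ((k : ℝ) ^ t) ^ (q - 2) * ((k : ℝ) ^ (-σ)) ^ q.choose 2 :=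
    ((isBigO_natCeil_rpow ht).pow _).mul (((isBigO_refl _ _).const_mul_left 2).pow _)
  -- `q.choose 2 - 1 = (q - 2) * ((q + 1) / 2)`
  have hexp : t * (q - 2 : ℕ) + -σ * q.choose 2 < -σ := by
    rw [Nat.cast_choose_two, Nat.cast_sub (by lia)]
    push_cast
    nlinarith
  refine hbigO.trans_isLittleO ((isLittleO_natCast_rpow_rpow hexp).congr' ?_ .rfl)
  filter_upwards [eventually_gt_atTop 0] with k hk
  rw [Real.rpow_add (by positivity), Real.rpow_mul_natCast k.cast_nonneg,
    Real.rpow_mul_natCast k.cast_nonneg]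

theorem eventually_exists_cliqueFree_indepSetFree (hq : 3 ≤ q) (ht : 0 < t)
    (htq : t < (q + 1) / 2) :
    ∀ᶠ k : ℕ in atTop, ∃ H : SimpleGraph (Fin ⌈(k : ℝ) ^ t⌉₊),
      H.CliqueFree q ∧ H.IndepSetFree k := by
  have hq' : (0 : ℝ) < (q + 1) / 2 := by positivity
  obtain ⟨σ, hσ, hσ1⟩ := exists_between ((div_lt_one hq').2 htq)
  have hσ0 : 0 < σ := (div_pos ht hq').trans hσ
  have hp : ∀ᶠ k : ℕ in atTop, (k : ℝ) ^ (-σ) < 1 / 2 :=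
    ((tendsto_rpow_neg_atTop hσ0).comp tendsto_natCast_atTop_atTop).eventually_lt_const
      (by norm_num)
  filter_upwards [hp, eventually_ge_atTop 2,
    (isLittleO_natCeil_pow_mul_pow_choose_two hq ht ((div_lt_iff₀ hq').1 hσ)).bound
      (c := 1 / 2) (by norm_num),
    (isLittleO_log_natCeil_rpow ht (sub_pos.2 hσ1)).bound (c := 1 / 16) (by norm_num)]
    with k hp hk hclique hlog
  have hk' : (2 : ℝ) ≤ k := by exact_mod_cast hk
  have hpos : 0 < (k : ℝ) ^ (-σ) := by positivity
  rw [Real.norm_of_nonneg (by positivity), Real.norm_of_nonneg (by positivity)] at hclique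
  rw [Real.norm_of_nonneg (Real.log_natCast_nonneg _), Real.norm_of_nonneg (by positivity)] at hlog
  refine exists_cliqueFree_indepSetFree_of_log_lt _ hpos.le hp.le (by lia) (by lia) ?_
  rw [Fintype.card_fin]
  calc Real.log ⌈(k : ℝ) ^ t⌉₊ ≤ 1 / 16 * (k : ℝ) ^ (1 - σ) := hlog
    _ = k / 16 * (k : ℝ) ^ (-σ) := by
        rw [sub_eq_add_neg, Real.rpow_add (by positivity), Real.rpow_one]
        ring
    _ < (k - 1) / 2 * (1 / 2 * (k : ℝ) ^ (-σ)) := by nlinarith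
    _ ≤ _ := by
        gcongr
        · linarith
        · linarith

end Asymptotics

section BindingFunctions

open Asymptotics Filter

theorem exists_le_cliqueNum_card_le_indepNum_mul {𝒢 : GraphClass} {f : ℕ → ℝ}
    (hf : 𝒢.IsTwOmegaBinding f) {V : Type} [Fintype V] {G : SimpleGraph V} (hG : 𝒢.Mem G) :
    ∃ ω ≤ G.cliqueNum, (Fintype.card V : ℝ) ≤ G.indepNum * (f ω + 1) := by
  refine ⟨_, SimpleGraph.cliqueNum_induce_le Set.univ, ?_⟩
  have hcard := card_le_indepNum_mul_treewidth_add_one (G.induce Set.univ)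
  rw [Fintype.card_setUniv] at hcard
  calc (Fintype.card V : ℝ)
      ≤ (G.induce Set.univ).indepNum * (treewidth (G.induce Set.univ) + 1) := mod_cast hcard
    _ ≤ G.indepNum * (f (G.induce Set.univ).cliqueNum + 1) := by
        gcongr
        · exact indepNum_induce_le G Set.univ
        · exact hf V G hG Set.univ

theorem exists_forall_le_mul_add_one_rpow {f : ℕ → ℝ} {s : ℝ} (hs : 0 ≤ s)
    (hf : f =O[atTop] fun k => (k : ℝ) ^ s) : ∃ C > 0, ∀ k, f k ≤ C * ((k : ℝ) + 1) ^ s := by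
  have hle : (fun k : ℕ => (k : ℝ) ^ s) =O[atTop] fun k => ((k : ℝ) + 1) ^ s :=
    .of_norm_le fun k => by
      rw [Real.norm_of_nonneg (by positivity)]
      gcongr
      linarith
  obtain ⟨C, hC, hbound⟩ := bound_of_isBigO_nat_atTop (hf.trans hle)
  refine ⟨C, hC, fun k => ?_⟩
  have hpos : 0 < ((k : ℝ) + 1) ^ s := by positivity
  simpa only [Real.norm_of_nonneg hpos.le] using (Real.le_norm_self _).trans (hbound hpos.ne')

theorem card_le_of_isTwOmegaBinding_boundedIndepClass {q k : ℕ} {f : ℕ → ℝ} {C s : ℝ}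
    (hf : (boundedIndepClass q).IsTwOmegaBinding f) (hC : 0 ≤ C) (hs : 0 ≤ s)
    (hfC : ∀ k, f k ≤ C * ((k : ℝ) + 1) ^ s) {V : Type} [Fintype V] {H : SimpleGraph V}
    (hclique : H.CliqueFree q) (hindep : H.IndepSetFree k) :
    (Fintype.card V : ℝ) ≤ q * (C * (k : ℝ) ^ s + 1) := by
  rw [← SimpleGraph.cliqueFree_compl, cliqueFree_iff_cliqueNum_lt] at hindep
  rw [cliqueFree_iff_cliqueNum_lt, ← SimpleGraph.indepNum_compl] at hclique
  obtain ⟨ω, hω, hcard⟩ := exists_le_cliqueNum_card_le_indepNum_mul hf hclique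
  have hωk : (ω : ℝ) + 1 ≤ k := by exact_mod_cast hω.trans_lt hindep
  calc (Fintype.card V : ℝ) ≤ Hᶜ.indepNum * (f ω + 1) := hcard
    _ ≤ Hᶜ.indepNum * (C * (k : ℝ) ^ s + 1) := by
        gcongr
        exact (hfC ω).trans (by gcongr)
    _ ≤ q * (C * (k : ℝ) ^ s + 1) := by gcongr

theorem not_isTwOmegaBinding_of_isBigO {q : ℕ} (hq : 3 ≤ q) {f : ℕ → ℝ} {s : ℝ}
    (hs : s < (q + 1) / 2) (hf : f =O[atTop] fun k => (k : ℝ) ^ s) :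
    ¬ (boundedIndepClass q).IsTwOmegaBinding f := by
  intro hbinding
  obtain ⟨s₀, hs₀, hs₀q⟩ := exists_between (max_lt hs (by positivity : (0 : ℝ) < (q + 1) / 2))
  obtain ⟨hss₀, hs₀pos⟩ := max_lt_iff.1 hs₀
  obtain ⟨t, hs₀t, htq⟩ := exists_between hs₀q
  obtain ⟨C, hC, hfC⟩ := exists_forall_le_mul_add_one_rpow hs₀pos.le
    (hf.trans (isLittleO_natCast_rpow_rpow hss₀).isBigO)
  have hlittle : (fun k : ℕ => (q : ℝ) * (C * (k : ℝ) ^ s₀ + 1)) =o[atTop]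
      fun k => (k : ℝ) ^ t := by
    have hone : (fun _ : ℕ => (1 : ℝ)) =o[atTop] fun k => (k : ℝ) ^ t := by
      simpa only [Real.rpow_zero] using isLittleO_natCast_rpow_rpow (hs₀pos.trans hs₀t)
    exact (((isLittleO_natCast_rpow_rpow hs₀t).const_mul_left C).add hone).const_mul_left q
  have hlt := hlittle.eventuallyLT_norm_of_eventually_pos <| by
    filter_upwards [eventually_gt_atTop 0] with k hk
    exact norm_pos_iff.2 (by positivity)
  obtain ⟨k, ⟨H, hclique, hindep⟩, hlt⟩ :=
    ((eventually_exists_cliqueFree_indepSetFree hq (hs₀pos.trans hs₀t) htq).and hlt).exists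
  rw [Real.norm_of_nonneg (by positivity), Real.norm_of_nonneg (by positivity)] at hlt
  have hcard := card_le_of_isTwOmegaBinding_boundedIndepClass hbinding hC.le hs₀pos.le hfC
    hclique hindep
  rw [Fintype.card_fin] at hcard
  exact ((Nat.le_ceil _).trans hcard).not_gt hlt

theorem isBigO_eval_natCast_rpow_natDegree (P : ℝ[X]) :
    (fun k : ℕ => P.eval (k : ℝ)) =O[atTop] fun k => (k : ℝ) ^ (P.natDegree : ℝ) := by
  have hdegree : P.degree ≤ (Polynomial.X ^ P.natDegree : ℝ[X]).degree := by
    rw [Polynomial.degree_X_pow]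
    exact Polynomial.degree_le_natDegree
  simpa only [Function.comp_def, Polynomial.eval_pow, Polynomial.eval_X, Real.rpow_natCast] using
    (P.isBigO_atTop_of_degree_le _ hdegree).comp_tendsto tendsto_natCast_atTop_atTop

end BindingFunctions

theorem mainTheorem12 :
    (∀ q : ℕ, 3 ≤ q →
      (boundedIndepClass q).IsTwOmegaBounded ∧
      (∃ (f : ℕ → ℕ) (p : ℝ[X]), p.natDegree = q - 1 ∧
        (∀ k : ℕ, (f k : ℝ) = p.eval (k : ℝ)) ∧
        (boundedIndepClass q).IsTwOmegaBinding fun k => (f k : ℝ)) ∧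
      (∀ c : ℝ, 0 < c → ∀ ε : ℝ, 0 < ε →
        ¬ (boundedIndepClass q).IsTwOmegaBinding
            fun k => c * (k : ℝ) ^ (((q : ℝ) + 1) / 2 - ε))) ∧
    ¬ ∃ p : ℝ[X], ∀ 𝒢 : GraphClass, 𝒢.IsPolynomiallyTwOmegaBounded →
        𝒢.IsTwOmegaBinding fun k => p.eval (k : ℝ) := by
  constructor
  · intro q hq
    have hbinding := isTwOmegaBinding_choose (show 1 ≤ q by lia)
    refine ⟨⟨_, hbinding⟩, ⟨_, .preHilbertPoly ℝ (q - 1) 0,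
      Polynomial.natDegree_preHilbertPoly ℝ (q - 1) 0,
      fun k => (eval_preHilbertPoly_zero (q - 1) k).symm, hbinding⟩, fun c _ ε hε => ?_⟩
    exact not_isTwOmegaBinding_of_isBigO hq (sub_lt_self _ hε)
      ((Asymptotics.isBigO_refl _ _).const_mul_left c)
  · rintro ⟨p, hp⟩
    set q := 2 * p.natDegree + 3 with hq
    have hdegree : (p.natDegree : ℝ) < (q + 1) / 2 := by
      push_cast [hq]
      linarith
    exact not_isTwOmegaBinding_of_isBigO (by lia) hdegree (isBigO_eval_natCast_rpow_natDegree p)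
      (hp _ (isPolynomiallyTwOmegaBounded_boundedIndepClass (by lia)))
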